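/- **Theorem 3.3.** Conventions. Let $G$ be a finite simple plane bipartite graph with a perfect matching (not necessarily connected), whose vertices are properly coloured white and black. A *cell* is an inner face whose boundary is a cycle; this cycle is also called a cell. Let $M$ be a perfect matching of $G$. A cell is *$M$-alternating* if the edges of its boundary cycle lie alternately in $M$ and not in $M$. An $M$-alternating cell is *proper* if every edge of the cycle belonging to $M$ goes from its white end to its black end in the clockwise orientation of the cycle; otherwise it is *improper*. For a cell $f$, $M\oplus f$ is the symmetric difference of $M$ and the edge set of $f$. Two cells *intersect* if their cycles have a common vertex. Let $\vec Z(G)$ be the digraph on the set $\mathcal M(G)$ of all perfect matchings of $G$ with an arc from $M_1$ to $M_2$ if and only if $M_1\oplus M_2$ is the edge set of a proper $M_1$-alternating cell, and order $\mathcal M(G)$ by: $M_1\le M_2$ if and only if $\vec Z(G)$ has a directed path (possibly of length $0$) from $M_2$ to $M_1$. An element of $\mathcal M(G)$ is *meet-irreducible* if it is covered by exactly one element. A cell $f$ is a *meet-irreducible cell with respect to $M$* if $f$ is a proper $M$-alternating cell and $M\oplus f$ is a meet-irreducible element of $\mathcal M(G)$. A graph is *elementary* if it has a perfect matching and the edges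 that lie in some perfect matching form a connected spanning subgraph. The plane bipartite graph $G$ is *weakly elementary* if, for every cycle $C$ of $G$ such that $G-V(C)$ has a perfect matching, the subgraph of $G$ consisting of $C$ together with its interior is elementary. For a set $S$ of pairwise disjoint $M$-alternating cells, the *hypercube generated by $S$* has as its vertices all perfect matchings $M\oplus\bigcup_{g\in T}E(g)$ with $T\subseteq S$. Statement. Let $G$ be a plane bipartite graph as above that is elementary or weakly elementary, let $M$ be a perfect matching of $G$, and let $f$ be a proper $M$-alternating cell. 1. If $G$ has no improper $M$-alternating cell, then every proper $M$-alternating cell is a meet-irreducible cell with respect to $M$. 2. If $G$ has at least one improper $M$-alternating cell, then the following are equivalent: (a) $f$ is a meet-irreducible cell with respect to $M$; (b) $f$ intersects every improper $M$-alternating cell; (c) there is no perfect matching $M'\ne M$ among the vertices of the hypercube generated by all improper $M$-alternating cells such that $f$ is a proper $M'$-alternating cell. -/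

import Mathlib

/-- The two colours of a properly coloured bipartite graph. -/
inductive VertexColour
  | white
  | black

/-- The set of all perfect matchings of `G`. A perfect matching is a spanning subgraph, so it is
determined by its edge set. -/
abbrev PerfectMatching {V : Type*} (G : SimpleGraph V) : Type _ :=
  {M : G.Subgraph // M.IsPerfectMatching}

/-- An edge is allowed if it lies in some perfect matching. -/
def IsAllowedEdge {V : Type*} (G : SimpleGraph V) (e : Sym2 V) : Prop :=
  ∃ M : PerfectMatching G, e ∈ M.1.edgeSet

/-- A graph is elementary if it has a perfect matching and its allowed edges form a connected
subgraph. (With a perfect matching present, the allowed edges cover all vertices, so the subgraph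
is spanning.) -/
def IsElementaryGraph {V : Type*} (G : SimpleGraph V) : Prop :=
  Nonempty (PerfectMatching G) ∧
    (SimpleGraph.fromEdgeSet {e : Sym2 V | IsAllowedEdge G e}).Connected

/-- A cycle `C` is nice if `G - V(C)` has a perfect matching. -/
def IsNiceCycle {V : Type*} {G : SimpleGraph V} {v : V} (C : G.Walk v v) : Prop :=
  C.IsCycle ∧ Nonempty (PerfectMatching (G.induce {u : V | u ∉ C.support}))

/-- A plane graph: a finite graph `G` without isolated vertices (automatic in the presence of a
perfect matching), possibly disconnected, drawn in the oriented plane without crossings, in the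
standard combinatorial description of such a drawing. `F` is the set of faces.

* `rot d` is the dart that follows `d` in the counterclockwise order around the tail of `d`; the
  darts leaving one vertex form one cycle of `rot`.
* `face d` is the face on the right-hand side of the dart `d`. A traveller along `d` who keeps
  this face on the right continues with the dart that follows the reverse of `d` in
  counterclockwise order.
* `outer` is the unbounded face. Hence a cycle that bounds an inner face is traversed clockwise by
  the darts having this face on their right.
* A facial walk lies on the boundary of one face, and the boundary of a face may consist of several
  facial walks, lying in different components of `G`. The components and the faces are linked
  together by incidence (`incidence_connected`), and the drawing is in the plane (that is, on the
  sphere, of genus zero) by Euler's formula `|V| - |E| + |F| = 1 + c`, with `c` the number of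
  components. Given `incidence_connected`, the left-hand side is at most the right-hand side for
  every choice of `rot` and `face`, and equality says exactly that each component has genus zero
  and that components and faces are incident in a tree-like way. -/
structure PlaneGraph {V : Type*} (G : SimpleGraph V) (F : Type*) where
  rot : Equiv.Perm G.Dart
  rot_sameCycle : ∀ d e : G.Dart, rot.SameCycle d e ↔ d.fst = e.fst
  face : G.Dart → F
  face_next : ∀ d : G.Dart, face (rot d.symm) = face d
  outer : F
  incidence_connected :
    (SimpleGraph.fromRel (fun x y : G.ConnectedComponent ⊕ F =>
      ∃ d : G.Dart, x = Sum.inl (G.connectedComponentMk d.fst) ∧ y = Sum.inr (face d))).Connected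
  euler : Nat.card V + Nat.card F = 1 + G.edgeSet.ncard + Nat.card G.ConnectedComponent

namespace PlaneGraph

variable {V F : Type*} {G : SimpleGraph V} (P : PlaneGraph G F)

/-- A cell: an inner face whose boundary is a cycle. -/
def IsCell (f : F) : Prop :=
  f ≠ P.outer ∧ ∃ (v : V) (C : G.Walk v v), C.IsCycle ∧
    ∀ d : G.Dart, P.face d = f ↔ d ∈ C.darts

/-- The boundary of a face, as a graph. For a cell it is a cycle (which is also called a cell). -/
def boundary (f : F) : SimpleGraph V :=
  SimpleGraph.fromEdgeSet {e : Sym2 V | ∃ d : G.Dart, P.face d = f ∧ d.edge = e}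

/-- Two cells intersect if their boundary cycles have a common vertex. -/
def Intersects (f g : F) : Prop :=
  ∃ v : V, v ∈ (P.boundary f).support ∧ v ∈ (P.boundary g).support

/-- `f` is an `M`-alternating cell. -/
def IsAlternatingCell (M : PerfectMatching G) (f : F) : Prop :=
  P.IsCell f ∧ (P.boundary f).IsAlternating M.1.spanningCoe

/-- `f` is a proper `M`-alternating cell: every edge of the cycle belonging to `M` goes from its
white end to its black end in the clockwise orientation of the cycle. -/
def IsProperCell (col : G.Coloring VertexColour) (M : PerfectMatching G) (f : F) : Prop :=
  P.IsAlternatingCell M f ∧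
    ∀ d : G.Dart, P.face d = f → d.edge ∈ M.1.edgeSet →
      col d.fst = VertexColour.white ∧ col d.snd = VertexColour.black

/-- `f` is an improper `M`-alternating cell: it is `M`-alternating, but not proper. -/
def IsImproperCell (col : G.Coloring VertexColour) (M : PerfectMatching G) (f : F) : Prop :=
  P.IsAlternatingCell M f ∧ ¬ P.IsProperCell col M f

/-- The arcs of the `Z`-transformation digraph: `M₁ → M₂` if `M₁ ⊕ M₂` is (the edge set of) a
proper `M₁`-alternating cell. -/
def Arc (col : G.Coloring VertexColour) (M₁ M₂ : PerfectMatching G) : Prop :=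
  ∃ f : F, P.IsProperCell col M₁ f ∧
    symmDiff M₁.1.edgeSet M₂.1.edgeSet = (P.boundary f).edgeSet

/-- The set of perfect matchings, as the carrier of the order below. -/
def MatchingPoset (_P : PlaneGraph G F) (_col : G.Coloring VertexColour) : Type _ :=
  PerfectMatching G

/-- `M₁ ≤ M₂` if the `Z`-transformation digraph has a directed path from `M₂` to `M₁`. -/
instance (col : G.Coloring VertexColour) : Preorder (P.MatchingPoset col) where
  le M₁ M₂ := Relation.ReflTransGen (P.Arc col) M₂ M₁
  le_refl _ := Relation.ReflTransGen.refl
  le_trans _ _ _ h₁ h₂ := h₂.trans h₁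

/-- `M` is meet-irreducible in the poset of perfect matchings: it is covered by exactly one
element. -/
def IsMeetIrreducible (col : G.Coloring VertexColour) (M : P.MatchingPoset col) : Prop :=
  ∃! N : P.MatchingPoset col, M ⋖ N

/-- `f` is a meet-irreducible cell with respect to `M`: it is a proper `M`-alternating cell and
the perfect matching `M ⊕ f` is meet-irreducible. -/
def IsMeetIrreducibleCell (col : G.Coloring VertexColour) (M : PerfectMatching G) (f : F) :
    Prop :=
  P.IsProperCell col M f ∧
    ∃ N : PerfectMatching G, N.1.edgeSet = symmDiff M.1.edgeSet (P.boundary f).edgeSet ∧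
      P.IsMeetIrreducible col N

/-- The vertex set of the hypercube of the `Z`-transformation digraph generated at `M` by a set
`S` of pairwise disjoint `M`-alternating cells: all perfect matchings that arise from `M` by
switching along the cells of a subset `T` of `S`. -/
def hypercube (M : PerfectMatching G) (S : Set F) : Set (PerfectMatching G) :=
  {M' | ∃ T : Set F, T ⊆ S ∧
    M'.1.edgeSet = symmDiff M.1.edgeSet (⋃ g ∈ T, (P.boundary g).edgeSet)}

/-- The faces in the interior of a cycle `C`: those that cannot be reached from the outer face by
crossing edges that are not on `C`. -/
def interiorFaces {v : V} (C : G.Walk v v) : Set F :=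
  {g | ¬ Relation.ReflTransGen
    (fun f₁ f₂ : F => ∃ d : G.Dart, d.edge ∉ C.edges ∧ P.face d = f₁ ∧ P.face d.symm = f₂)
    P.outer g}

/-- The subgraph of `G` consisting of a cycle `C` together with its interior. -/
def cycleWithInterior {v : V} (C : G.Walk v v) : G.Subgraph :=
  C.toSubgraph ⊔
    { verts := {u | ∃ d : G.Dart, d.fst = u ∧
        (P.face d ∈ P.interiorFaces C ∨ P.face d.symm ∈ P.interiorFaces C)}
      Adj := fun u w => ∃ d : G.Dart, d.fst = u ∧ d.snd = w ∧
        (P.face d ∈ P.interiorFaces C ∨ P.face d.symm ∈ P.interiorFaces C)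
      adj_sub := by
        rintro u w ⟨d, rfl, rfl, -⟩
        exact d.adj
      edge_vert := by
        rintro u w ⟨d, rfl, -, h⟩
        exact ⟨d, rfl, h⟩
      symm := ⟨by
        rintro u w ⟨d, rfl, rfl, h⟩
        exact ⟨d.symm, rfl, rfl, by simpa using h.symm⟩⟩ }

/-- A plane bipartite graph is weakly elementary if every nice cycle together with its interior
is an elementary graph. -/
def IsWeaklyElementary : Prop :=
  ∀ (v : V) (C : G.Walk v v), IsNiceCycle C → IsElementaryGraph (P.cycleWithInterior C).coe

end PlaneGraph

namespace VertexColour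

/-! The crux is `covBy_iff_arc`: the covers of a matching `N` are exactly the matchings obtained by
switching an improper `N`-alternating cell. For this, a directed path is recorded by a height
function on the faces that counts how often each cell is switched. Heights are determined by the two
end matchings (`IsHeight.unique`) and zero height means equality, so the order is antisymmetric; a
single arc has height the indicator of one face, which is not a sum of two nonzero functions to `ℕ`,
so nothing lies strictly between its ends.

Now let `N = M ⊕ f`. The cell `f` is improper for `N`, giving the cover `M`. Another improper cell
of `N` is disjoint from `f` by `IsDirectedCell.eq_of_intersects`, and on cells disjoint from `f` the
matchings `M` and `N` agree. Hence further covers correspond to improper `M`-alternating cells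
missing `f`, and `f` is meet-irreducible iff there are none. The hypercube condition follows from
the `M`-edge at a common vertex: switching an improper cell that meets `f` destroys an `M`-edge of
`f`. -/

theorem eq_of_ne_of_ne {a b c : VertexColour} (hab : a ≠ b) (hbc : b ≠ c) : a = c := by
  cases a <;> cases b <;> cases c <;> simp_all

end VertexColour

namespace PlaneGraph

variable {V F : Type*} {G : SimpleGraph V} (P : PlaneGraph G F)

section Matchings

theorem PerfectMatching.ext_edgeSet {M N : PerfectMatching G}
    (h : M.1.edgeSet = N.1.edgeSet) : M = N := by
  apply Subtype.ext
  apply SimpleGraph.Subgraph.ext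
  · ext v
    exact iff_of_true (M.2.2 v) (N.2.2 v)
  · ext v w
    rw [← SimpleGraph.Subgraph.mem_edgeSet, h, SimpleGraph.Subgraph.mem_edgeSet]

theorem PerfectMatching.dart_eq (M : PerfectMatching G) {d e : G.Dart} (hd : d.edge ∈ M.1.edgeSet)
    (he : e.edge ∈ M.1.edgeSet) (h : d.fst = e.fst) : d = e := by
  obtain ⟨⟨a, b⟩, hab⟩ := d
  obtain ⟨⟨a', b'⟩, hab'⟩ := e
  obtain rfl : a = a' := h
  obtain rfl : b = b' := M.2.1.eq_of_adj_left hd he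
  rfl

end Matchings

/-! ### Facial walks and boundaries of faces. -/

section Faces

theorem rot_fst (d : G.Dart) : (P.rot d).fst = d.fst :=
  ((P.rot_sameCycle d (P.rot d)).1 ⟨1, by simp⟩).symm

/-- The dart that follows `d` along the face on its right. -/
def next (d : G.Dart) : G.Dart := P.rot d.symm

/-- The dart that precedes `d` along the face on its right. -/
def prev (d : G.Dart) : G.Dart := (P.rot.symm d).symm

theorem next_fst (d : G.Dart) : (P.next d).fst = d.snd := P.rot_fst _

theorem face_next' (d : G.Dart) : P.face (P.next d) = P.face d := P.face_next d

theorem next_prev (d : G.Dart) : P.next (P.prev d) = d := by simp [next, prev]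

theorem prev_snd (d : G.Dart) : (P.prev d).snd = d.fst := by
  rw [← P.next_fst, P.next_prev]

theorem face_prev (d : G.Dart) : P.face (P.prev d) = P.face d := by
  rw [← P.face_next', P.next_prev]

theorem mem_boundary {f : F} {e : Sym2 V} :
    e ∈ (P.boundary f).edgeSet ↔ ∃ d : G.Dart, P.face d = f ∧ d.edge = e := by
  simp only [boundary, SimpleGraph.edgeSet_fromEdgeSet, Set.mem_sdiff, Set.mem_ofPred_eq]
  refine ⟨fun h => h.1, fun h => ⟨h, ?_⟩⟩
  obtain ⟨d, -, rfl⟩ := h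
  exact G.not_isDiag_of_mem_edgeSet d.edge_mem

theorem edge_mem_boundary {f : F} {e : G.Dart} :
    e.edge ∈ (P.boundary f).edgeSet ↔ P.face e = f ∨ P.face e.symm = f := by
  rw [mem_boundary]
  constructor
  · rintro ⟨d, hd, h⟩
    rcases SimpleGraph.dart_edge_eq_iff d e |>.1 h with rfl | rfl
    · exact .inl hd
    · exact .inr hd
  · rintro (h | h)
    · exact ⟨e, h, rfl⟩
    · exact ⟨e.symm, h, by simp⟩

theorem mem_boundary_support {f : F} {v : V} :
    v ∈ (P.boundary f).support ↔ ∃ d : G.Dart, P.face d = f ∧ d.fst = v := by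
  constructor
  · rintro ⟨w, hw⟩
    obtain ⟨d, hd, h⟩ := P.mem_boundary.1 ((SimpleGraph.mem_edgeSet _).2 hw)
    rcases SimpleGraph.dart_edge_eq_mk'_iff'.1 h with h | h
    · exact ⟨d, hd, h.1⟩
    · exact ⟨P.next d, (P.face_next' d).trans hd, (P.next_fst d).trans h.2⟩
  · rintro ⟨d, hd, rfl⟩
    exact ⟨d.snd, (SimpleGraph.mem_edgeSet _).1 (P.mem_boundary.2 ⟨d, hd, rfl⟩)⟩

theorem fst_mem_boundary_support {f : F} {d : G.Dart}
    (h : d.edge ∈ (P.boundary f).edgeSet) : d.fst ∈ (P.boundary f).support :=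
  ⟨d.snd, h⟩

end Faces

/-! ### Darts on the boundary of a cell. -/

section Cells

variable {P} {f g : F}

theorem IsCell.exists_dart (hf : P.IsCell f) : ∃ d : G.Dart, P.face d = f := by
  obtain ⟨-, v, C, hC, h⟩ := hf
  cases C with
  | nil => exact absurd rfl hC.ne_nil
  | cons hadj p => exact ⟨_, (h _).2 (by rw [SimpleGraph.Walk.darts_cons]; exact List.mem_cons_self)⟩

theorem IsCell.eq_of_snd (hf : P.IsCell f) {d e : G.Dart} (hd : P.face d = f)
    (he : P.face e = f) (h : d.snd = e.snd) : d = e := by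
  obtain ⟨-, v, C, hC, hface⟩ := hf
  -- The heads of the darts of `C` form `support.tail`, which has no repetition on a cycle.
  have hn := hC.support_nodup
  rw [← SimpleGraph.Walk.map_snd_darts] at hn
  exact List.inj_on_of_nodup_map hn ((hface d).1 hd) ((hface e).1 he) h

theorem IsCell.eq_of_fst (hf : P.IsCell f) {d e : G.Dart} (hd : P.face d = f)
    (he : P.face e = f) (h : d.fst = e.fst) : d = e := by
  rw [← P.next_prev d, ← P.next_prev e]
  congr 1
  exact hf.eq_of_snd ((P.face_prev d).trans hd) ((P.face_prev e).trans he)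
    (by rw [P.prev_snd, P.prev_snd, h])

theorem IsCell.face_symm_ne (hf : P.IsCell f) {d : G.Dart} (hd : P.face d = f) :
    P.face d.symm ≠ f := by
  intro hs
  obtain ⟨-, v, C, hC, hface⟩ := hf
  exact d.symm_ne (List.inj_on_of_nodup_map hC.isCircuit.isTrail.edges_nodup
    ((hface _).1 hs) ((hface d).1 hd) (by simp))

theorem IsCell.fst_prev_ne_snd (hf : P.IsCell f) {d : G.Dart} (hd : P.face d = f) :
    (P.prev d).fst ≠ d.snd := by
  intro h
  have hs : P.prev d = d.symm := SimpleGraph.Dart.ext _ _ (Prod.ext h (P.prev_snd d))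
  exact hf.face_symm_ne hd (by rw [← hs, P.face_prev, hd])

theorem IsCell.boundary_adj_iff (hf : P.IsCell f) {d : G.Dart} (hd : P.face d = f) (w : V) :
    (P.boundary f).Adj d.fst w ↔ w = d.snd ∨ w = (P.prev d).fst := by
  rw [← SimpleGraph.mem_edgeSet, mem_boundary]
  constructor
  · rintro ⟨e, he, h⟩
    rcases SimpleGraph.dart_edge_eq_mk'_iff'.1 h with h | h
    · exact .inl (by rw [← hf.eq_of_fst he hd h.1, h.2])
    · exact .inr (by
        rw [← hf.eq_of_snd he ((P.face_prev d).trans hd) (h.2.trans (P.prev_snd d).symm), h.1])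
  · rintro (rfl | rfl)
    · exact ⟨d, hd, rfl⟩
    · refine ⟨P.prev d, (P.face_prev d).trans hd, ?_⟩
      rw [SimpleGraph.dart_edge_eq_mk'_iff']
      exact .inr ⟨rfl, P.prev_snd d⟩

/-- A property of darts that is passed on along the boundary of a cell holds for all of its darts
or for none. -/
theorem IsCell.iff_of_next (hf : P.IsCell f) {q : G.Dart → Prop}
    (hq : ∀ d, P.face d = f → (q d ↔ q (P.next d))) {d e : G.Dart} (hd : P.face d = f)
    (he : P.face e = f) : q d ↔ q e := by
  -- The induction runs over tails of the cycle; `a` is the boundary dart leaving `u`, hence the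
  -- first dart of `p` when `p` is not empty.
  have key : ∀ {u v : V} (p : G.Walk u v), (∀ a ∈ p.darts, P.face a = f) →
      ∀ a : G.Dart, P.face a = f → a.fst = u → ∀ b ∈ p.darts, q b ↔ q a := by
    intro u v p
    induction p with
    | nil => simp
    | cons hadj p ih =>
      intro hp a ha hau b hb
      have h0 := hp ⟨(_, _), hadj⟩ (by simp)
      have ha' := hf.eq_of_fst ha h0 hau
      rw [SimpleGraph.Walk.darts_cons, List.mem_cons] at hb
      rcases hb with rfl | hb
      · rw [ha']
      · rw [ih (fun c hc => hp c (by simp [hc])) (P.next a) ((P.face_next' a).trans ha)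
          (by rw [P.next_fst, ha']) b hb, hq a ha]
  obtain ⟨-, v, C, hC, hface⟩ := id hf
  cases C with
  | nil => exact absurd rfl hC.ne_nil
  | cons hadj p =>
    have hk := key (.cons hadj p) (fun a ha => (hface a).2 ha) ⟨(_, _), hadj⟩
      ((hface _).2 (by simp)) rfl
    rw [hk d ((hface d).1 hd), hk e ((hface e).1 he)]

end Cells

/-- `f` is a cell whose matched edges are those traversed clockwise from their end of colour
`c`. -/
def IsDirectedCell (col : G.Coloring VertexColour) (c : VertexColour) (M : PerfectMatching G)
    (f : F) : Prop :=
  P.IsCell f ∧ ∀ d : G.Dart, P.face d = f → (d.edge ∈ M.1.edgeSet ↔ col d.fst = c)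

/-! ### Proper and improper cells as directed cells, and switching. -/

section Directed

variable {P} {f g : F} {col : G.Coloring VertexColour} {c : VertexColour} {M N : PerfectMatching G}

theorem colour_fst_iff (col : G.Coloring VertexColour) (d : G.Dart) (c : VertexColour) :
    col d.fst = c ↔ col d.snd ≠ c := by
  have h : col d.fst ≠ col d.snd := col.valid d.adj
  refine ⟨fun h1 h2 => h (h1.trans h2.symm), VertexColour.eq_of_ne_of_ne h⟩

theorem IsAlternatingCell.edge_mem_iff (h : P.IsAlternatingCell M f) {d : G.Dart}
    (hd : P.face d = f) : d.edge ∈ M.1.edgeSet ↔ (P.next d).edge ∉ M.1.edgeSet := by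
  have hn : P.face (P.next d) = f := (P.face_next' d).trans hd
  have hp : P.prev (P.next d) = d := h.1.eq_of_snd ((P.face_prev _).trans hn) hd
    (by rw [P.prev_snd, P.next_fst])
  have hne := h.1.fst_prev_ne_snd hn
  have h1 := (h.1.boundary_adj_iff hn _).2 (.inr rfl)
  have h2 := (h.1.boundary_adj_iff hn _).2 (.inl rfl)
  have := h.2 hne h1 h2
  rw [hp, P.next_fst, SimpleGraph.Subgraph.spanningCoe_adj,
    SimpleGraph.Subgraph.spanningCoe_adj, SimpleGraph.Subgraph.adj_comm] at this
  rw [← P.next_fst] at this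
  change M.1.Adj d.fst d.snd ↔ _
  rw [← P.next_fst d]
  exact this

/-- From one boundary dart to the next, both membership in `M` and the colour of the tail flip, so
whether they agree is the same for all darts. -/
theorem IsAlternatingCell.isDirectedCell (h : P.IsAlternatingCell M f) :
    P.IsDirectedCell col VertexColour.white M f ∨ P.IsDirectedCell col VertexColour.black M f := by
  obtain ⟨e, he⟩ := h.1.exists_dart
  have key : ∀ d, P.face d = f →
      ((d.edge ∈ M.1.edgeSet ↔ col d.fst = VertexColour.white) ↔
        (e.edge ∈ M.1.edgeSet ↔ col e.fst = VertexColour.white)) := by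
    intro d hd
    refine h.1.iff_of_next
      (q := fun d => (d.edge ∈ M.1.edgeSet ↔ col d.fst = VertexColour.white)) ?_ hd he
    intro a ha
    have h1 := h.edge_mem_iff ha
    have h2 := colour_fst_iff col a VertexColour.white
    rw [← P.next_fst] at h2
    tauto
  by_cases hq : (e.edge ∈ M.1.edgeSet ↔ col e.fst = VertexColour.white)
  · exact .inl ⟨h.1, fun d hd => (key d hd).2 hq⟩
  · refine .inr ⟨h.1, fun d hd => ?_⟩
    have h1 := (key d hd).not.2 hq
    have h2 : col d.fst = VertexColour.black ↔ ¬ col d.fst = VertexColour.white := by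
      cases col d.fst <;> simp
    tauto

theorem IsDirectedCell.isAlternatingCell (h : P.IsDirectedCell col c M f) :
    P.IsAlternatingCell M f := by
  refine ⟨h.1, fun v w w' hne hw hw' => ?_⟩
  obtain ⟨d, hd, rfl⟩ := P.mem_boundary_support.1 ⟨w, hw⟩
  have h1 := h.2 d hd
  have h2 := h.2 (P.prev d) ((P.face_prev d).trans hd)
  rw [colour_fst_iff, P.prev_snd] at h2
  have h3 : M.1.Adj d.fst d.snd ↔ ¬ M.1.Adj d.fst (P.prev d).fst := by
    have h4 : M.1.Adj d.fst (P.prev d).fst ↔ (P.prev d).edge ∈ M.1.edgeSet := by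
      change _ ↔ M.1.Adj (P.prev d).fst (P.prev d).snd
      rw [P.prev_snd, M.1.adj_comm]
    change d.edge ∈ M.1.edgeSet ↔ _
    tauto
  simp only [SimpleGraph.Subgraph.spanningCoe_adj]
  rcases (h.1.boundary_adj_iff hd w).1 hw with rfl | rfl <;>
    rcases (h.1.boundary_adj_iff hd w').1 hw' with rfl | rfl
  · exact absurd rfl hne
  · exact h3
  · tauto
  · exact absurd rfl hne

theorem IsDirectedCell.colour_unique {c' : VertexColour} (h : P.IsDirectedCell col c M f)
    (h' : P.IsDirectedCell col c' M f) : c = c' := by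
  obtain ⟨d, hd⟩ := h.1.exists_dart
  have key : ∀ e, P.face e = f → col e.fst = c → c = c' := fun e he hc =>
    hc.symm.trans ((h'.2 e he).1 ((h.2 e he).2 hc))
  by_cases hc : col d.fst = c
  · exact key d hd hc
  · refine key (P.next d) ((P.face_next' d).trans hd) ?_
    rw [P.next_fst]
    rw [colour_fst_iff] at hc
    exact not_not.1 hc

theorem isProperCell_iff :
    P.IsProperCell col M f ↔ P.IsDirectedCell col VertexColour.white M f := by
  constructor
  · rintro ⟨ha, hp⟩
    rcases ha.isDirectedCell (col := col) with h | h
    · exact h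
    · refine ⟨h.1, fun d hd => ⟨fun hm => (hp d hd hm).1, fun hw => ?_⟩⟩
      by_contra hm
      have hn : (P.next d).edge ∈ M.1.edgeSet := by
        by_contra h'
        exact hm ((ha.edge_mem_iff hd).2 h')
      have hf := (P.face_next' d).trans hd
      have := (hp _ hf hn).1
      rw [(h.2 _ hf).1 hn] at this
      cases this
  · intro h
    refine ⟨h.isAlternatingCell, fun d hd hm => ?_⟩
    have h1 := (h.2 d hd).1 hm
    have h2 : col d.fst ≠ col d.snd := col.valid d.adj
    refine ⟨h1, ?_⟩
    rw [h1] at h2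
    revert h2
    cases col d.snd <;> simp

theorem isImproperCell_iff :
    P.IsImproperCell col M f ↔ P.IsDirectedCell col VertexColour.black M f := by
  rw [IsImproperCell, isProperCell_iff]
  constructor
  · rintro ⟨ha, hp⟩
    exact ha.isDirectedCell.resolve_left hp
  · intro h
    refine ⟨h.isAlternatingCell, fun h' => ?_⟩
    cases h.colour_unique h'

/-- The matched dart of a directed cell at a vertex of its boundary. -/
theorem IsDirectedCell.exists_matched (h : P.IsDirectedCell col c M f) {v : V}
    (hv : v ∈ (P.boundary f).support) : ∃ d : G.Dart, P.face d = f ∧ d.edge ∈ M.1.edgeSet ∧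
      ((col v = c ∧ d.fst = v) ∨ (col v ≠ c ∧ d.snd = v)) := by
  obtain ⟨d, hd, rfl⟩ := P.mem_boundary_support.1 hv
  by_cases hc : col d.fst = c
  · exact ⟨d, hd, (h.2 d hd).2 hc, .inl ⟨hc, rfl⟩⟩
  · have hp := (P.face_prev d).trans hd
    refine ⟨P.prev d, hp, (h.2 _ hp).2 ?_, .inr ⟨hc, P.prev_snd d⟩⟩
    rw [colour_fst_iff, P.prev_snd]
    exact hc

/-- The matched edge at a common vertex lies on both cells, and the colour of that vertex fixes the
direction in which each traverses it. The cells thus share a dart, and a dart has only one face on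
its right. -/
theorem IsDirectedCell.eq_of_intersects (hf : P.IsDirectedCell col c M f)
    (hg : P.IsDirectedCell col c M g) (h : P.Intersects f g) : f = g := by
  obtain ⟨v, hvf, hvg⟩ := h
  obtain ⟨d, hd, hdM, hdv⟩ := hf.exists_matched hvf
  obtain ⟨e, he, heM, hev⟩ := hg.exists_matched hvg
  have : d = e := by
    rcases hdv with ⟨hc, hdv⟩ | ⟨hc, hdv⟩ <;> rcases hev with ⟨hc', hev⟩ | ⟨hc', hev⟩
    · exact PerfectMatching.dart_eq M hdM heM (hdv.trans hev.symm)
    · exact absurd hc hc'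
    · exact absurd hc' hc
    · apply SimpleGraph.Dart.symm_involutive.injective
      exact PerfectMatching.dart_eq M (by simpa using hdM) (by simpa using heM)
        (hdv.trans hev.symm)
  rw [← hd, ← he, this]

theorem not_edge_mem_boundary_of_not_intersects (h : ¬ P.Intersects f g) {d : G.Dart}
    (hd : P.face d = f) : d.edge ∉ (P.boundary g).edgeSet := fun hg =>
  h ⟨d.fst, P.mem_boundary_support.2 ⟨d, hd, rfl⟩, P.fst_mem_boundary_support hg⟩

/-- Switching along a cell disjoint from `f` does not affect `f`. -/
theorem IsDirectedCell.congr_of_not_intersects (h : ¬ P.Intersects f g)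
    (hN : N.1.edgeSet = symmDiff M.1.edgeSet (P.boundary g).edgeSet) :
    P.IsDirectedCell col c N f ↔ P.IsDirectedCell col c M f := by
  refine and_congr_right fun _ => forall₂_congr fun d hd => ?_
  have := not_edge_mem_boundary_of_not_intersects h hd
  rw [hN, Set.mem_symmDiff]
  tauto

/-- Switching along `f` reverses its direction. -/
theorem IsDirectedCell.reverse {c' : VertexColour} (hc : c ≠ c')
    (hN : N.1.edgeSet = symmDiff M.1.edgeSet (P.boundary f).edgeSet)
    (h : P.IsDirectedCell col c M f) : P.IsDirectedCell col c' N f := by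
  refine ⟨h.1, fun d hd => ?_⟩
  have h1 : d.edge ∈ (P.boundary f).edgeSet := P.mem_boundary.2 ⟨d, hd, rfl⟩
  have h2 := h.2 d hd
  have h3 : col d.fst = c' ↔ col d.fst ≠ c :=
    ⟨fun h h' => hc (h'.symm.trans h), fun h => VertexColour.eq_of_ne_of_ne h hc⟩
  rw [hN, Set.mem_symmDiff]
  tauto

/-- At a vertex of the cycle exactly one of the two boundary edges is matched and switching
exchanges them; at all other vertices nothing changes. -/
theorem IsDirectedCell.exists_switch (h : P.IsDirectedCell col c M f) :
    ∃ N : PerfectMatching G, N.1.edgeSet = symmDiff M.1.edgeSet (P.boundary f).edgeSet := by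
  let N : G.Subgraph :=
    { verts := Set.univ
      Adj := fun v w => s(v, w) ∈ symmDiff M.1.edgeSet (P.boundary f).edgeSet
      adj_sub := by
        rintro v w (⟨hm, -⟩ | ⟨hb, -⟩)
        · exact M.1.adj_sub hm
        · obtain ⟨d, -, hd⟩ := P.mem_boundary.1 hb
          rw [← SimpleGraph.mem_edgeSet, ← hd]
          exact d.edge_mem
      edge_vert := fun _ => Set.mem_univ _
      symm := ⟨fun v w hvw => by rwa [Sym2.eq_swap]⟩ }
  have hN : N.edgeSet = symmDiff M.1.edgeSet (P.boundary f).edgeSet := by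
    ext e
    induction e using Sym2.ind
    rfl
  refine ⟨⟨N, SimpleGraph.Subgraph.isPerfectMatching_iff.2 fun v => ?_⟩, hN⟩
  have hadj : ∀ w, N.Adj v w ↔ M.1.Adj v w ∧ ¬ (P.boundary f).Adj v w ∨
      (P.boundary f).Adj v w ∧ ¬ M.1.Adj v w := fun w => Iff.rfl
  simp only [hadj]
  obtain ⟨m, hm, hmu⟩ := SimpleGraph.Subgraph.isPerfectMatching_iff.1 M.2 v
  by_cases hv : v ∈ (P.boundary f).support
  · obtain ⟨d, hd, rfl⟩ := P.mem_boundary_support.1 hv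
    have hb := h.1.boundary_adj_iff hd
    have hne := h.1.fst_prev_ne_snd hd
    have halt := h.isAlternatingCell.2 hne ((hb _).2 (.inr rfl)) ((hb _).2 (.inl rfl))
    simp only [SimpleGraph.Subgraph.spanningCoe_adj] at halt
    simp only [hb]
    by_cases hs : M.1.Adj d.fst d.snd
    · refine ⟨(P.prev d).fst, .inr ⟨.inr rfl, by tauto⟩, ?_⟩
      rintro w (⟨hw, hw'⟩ | ⟨rfl | rfl, hw⟩)
      · exact absurd (.inl ((hmu w hw).trans (hmu _ hs).symm)) hw'
      · exact absurd hs hw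
      · rfl
    · refine ⟨d.snd, .inr ⟨.inl rfl, hs⟩, ?_⟩
      rintro w (⟨hw, hw'⟩ | ⟨rfl | rfl, hw⟩)
      · exact absurd (.inr ((hmu w hw).trans (hmu _ (halt.2 hs)).symm)) hw'
      · rfl
      · exact absurd (halt.2 hs) hw
  · have hb : ∀ w, ¬ (P.boundary f).Adj v w := fun w hw => hv ⟨w, hw⟩
    exact ⟨m, .inl ⟨hm, hb m⟩, fun w hw => hmu w (hw.resolve_right fun h => hb w h.1).1⟩

end Directed

/-! ### Height functions on the faces. -/

section Height

variable {P}

/-- Invariance across edges makes `k` constant on the faces around a vertex, then along walks, hence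
on the faces incident with one component; `incidence_connected` links the components. -/
theorem eq_of_face_eq_face_symm {α : Type*} {k : F → α}
    (hk : ∀ d : G.Dart, k (P.face d) = k (P.face d.symm)) (x y : F) : k x = k y := by
  have hrot : ∀ d, k (P.face (P.rot d)) = k (P.face d) := by
    intro d
    have := P.face_next d.symm
    rw [SimpleGraph.Dart.symm_symm] at this
    rw [this, ← hk]
  have hfst : ∀ d e : G.Dart, d.fst = e.fst → k (P.face d) = k (P.face e) := by
    intro d e hde
    obtain ⟨i, rfl⟩ := (P.rot_sameCycle d e).2 hde
    induction i with
    | zero => simp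
    | succ n ih =>
      rw [add_comm, zpow_add, zpow_one, Equiv.Perm.mul_apply, hrot]
      exact ih (by rw [← (P.rot_sameCycle _ _)]; exact ⟨_, rfl⟩)
    | pred n ih =>
      rw [← hrot ((P.rot ^ (-(n : ℤ) - 1)) d), ← Equiv.Perm.mul_apply, ← zpow_one_add]
      rw [show (1 : ℤ) + (-(n : ℤ) - 1) = -n by ring]
      exact ih (by rw [← (P.rot_sameCycle _ _)]; exact ⟨_, rfl⟩)
  have hreach : ∀ {u v : V} (p : G.Walk u v) (d e : G.Dart), d.fst = u → e.fst = v →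
      k (P.face d) = k (P.face e) := by
    intro u v p
    induction p with
    | nil => exact fun d e hd he => hfst d e (hd.trans he.symm)
    | cons hadj p ih =>
      intro d e hd he
      rw [hfst d ⟨(_, _), hadj⟩ hd, hk, ih _ e rfl he]
  have hcomp : ∀ d e : G.Dart, G.connectedComponentMk d.fst = G.connectedComponentMk e.fst →
      k (P.face d) = k (P.face e) := by
    intro d e hde
    obtain ⟨p⟩ := SimpleGraph.ConnectedComponent.exact hde
    exact hreach p d e rfl rfl
  -- Along the incidence graph, both a face and a component determine a value of `k`.
  let Q : G.ConnectedComponent ⊕ F → Prop := Sum.elim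
    (fun K => ∀ d : G.Dart, G.connectedComponentMk d.fst = K → k (P.face d) = k x)
    (fun z => k z = k x)
  have hstep : ∀ a b, (SimpleGraph.fromRel (fun x y : G.ConnectedComponent ⊕ F =>
      ∃ d : G.Dart, x = Sum.inl (G.connectedComponentMk d.fst) ∧ y = Sum.inr (P.face d))).Adj a b →
      Q a → Q b := by
    intro a b hab ha
    rcases hab.2 with ⟨d, rfl, rfl⟩ | ⟨d, rfl, rfl⟩
    · exact ha d rfl
    · exact fun e he => (hcomp e d he).trans ha
  obtain ⟨p⟩ := P.incidence_connected.preconnected (Sum.inr x) (Sum.inr y)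
  have hwalk : ∀ {a b} (p : (SimpleGraph.fromRel (fun x y : G.ConnectedComponent ⊕ F =>
      ∃ d : G.Dart, x = Sum.inl (G.connectedComponentMk d.fst) ∧
        y = Sum.inr (P.face d))).Walk a b), Q a → Q b := by
    intro a b p
    induction p with
    | nil => exact id
    | cons hadj p ih => exact fun ha => ih (hstep _ _ hadj ha)
  exact (hwalk p (show k x = k x from rfl)).symm

open Classical in
/-- `h` is the height difference of `M₁` and `M₂`: a function on the faces that vanishes on the
outer face and whose jumps across the edges describe the difference of the matchings. -/
def IsHeight (P : PlaneGraph G F) (col : G.Coloring VertexColour) (M₁ M₂ : PerfectMatching G)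
    (h : F → ℕ) : Prop :=
  h P.outer = 0 ∧ ∀ d : G.Dart, col d.fst = VertexColour.white →
    (if d.edge ∈ M₁.1.edgeSet then 1 else 0 : ℤ) - (if d.edge ∈ M₂.1.edgeSet then 1 else 0) =
      h (P.face d) - h (P.face d.symm)

variable {col : G.Coloring VertexColour} {M₁ M₂ M₃ : PerfectMatching G} {h h' : F → ℕ}

theorem IsHeight.refl (M : PerfectMatching G) : P.IsHeight col M M 0 := by
  simp [IsHeight]

theorem IsHeight.trans (h₁ : P.IsHeight col M₁ M₂ h) (h₂ : P.IsHeight col M₂ M₃ h') :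
    P.IsHeight col M₁ M₃ (h + h') := by
  refine ⟨by simp [h₁.1, h₂.1], fun d hd => ?_⟩
  have e₁ := h₁.2 d hd
  have e₂ := h₂.2 d hd
  simp only [Pi.add_apply, Nat.cast_add]
  linarith

-- Seen from its white end, a boundary edge has `f` on the right if it is lost and on the left if it
-- is gained, which matches the jump of the indicator of `f`. The outer face is not a cell, so the
-- height vanishes there.
open Classical in
theorem IsHeight.of_switch {f : F} (hf : P.IsProperCell col M₁ f)
    (hM : symmDiff M₁.1.edgeSet M₂.1.edgeSet = (P.boundary f).edgeSet) :
    P.IsHeight col M₁ M₂ (Pi.single f 1) := by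
  rw [isProperCell_iff] at hf
  refine ⟨Pi.single_eq_of_ne hf.1.1.symm _, fun d hd => ?_⟩
  have hb : d.edge ∈ (P.boundary f).edgeSet ↔ _ := P.edge_mem_boundary
  rw [← hM, Set.mem_symmDiff] at hb
  by_cases h1 : P.face d = f
  · have h2 := hf.1.face_symm_ne h1
    have h3 := (hf.2 d h1).2 hd
    have h4 : d.edge ∉ M₂.1.edgeSet := by tauto
    simp [h1, h2, h3, h4]
  · by_cases h2 : P.face d.symm = f
    · have h3 : d.edge ∉ M₁.1.edgeSet := by
        have := hf.2 d.symm h2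
        rw [SimpleGraph.Dart.edge_symm] at this
        rw [this, colour_fst_iff]
        exact not_not.2 hd
      have h4 : d.edge ∈ M₂.1.edgeSet := by tauto
      simp [h1, h2, h3, h4]
    · have h3 : d.edge ∈ M₁.1.edgeSet ↔ d.edge ∈ M₂.1.edgeSet := by tauto
      simp [h1, h2, h3]

/-- The difference of two heights has no jumps, so it is constant, and it vanishes at the outer
face. -/
theorem IsHeight.unique (h₁ : P.IsHeight col M₁ M₂ h) (h₂ : P.IsHeight col M₁ M₂ h') :
    h = h' := by
  have hw : ∀ d : G.Dart, col d.fst = VertexColour.white →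
      (h (P.face d) : ℤ) - h' (P.face d) = h (P.face d.symm) - h' (P.face d.symm) := by
    intro d hd
    have e₁ := h₁.2 d hd
    have e₂ := h₂.2 d hd
    linarith
  have key := eq_of_face_eq_face_symm (P := P) (k := fun x => (h x : ℤ) - h' x) (by
    intro d
    by_cases hd : col d.fst = VertexColour.white
    · exact hw d hd
    · rw [colour_fst_iff, not_not] at hd
      have := hw d.symm hd
      rw [SimpleGraph.Dart.symm_symm] at this
      exact this.symm)
  funext x
  have := key x P.outer
  simp only [h₁.1, h₂.1] at this
  omega

theorem IsHeight.eq_of_zero (h₁ : P.IsHeight col M₁ M₂ 0) : M₁ = M₂ := by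
  have hw : ∀ d : G.Dart, col d.fst = VertexColour.white →
      (d.edge ∈ M₁.1.edgeSet ↔ d.edge ∈ M₂.1.edgeSet) := by
    intro d hd
    have e₁ := h₁.2 d hd
    by_cases h1 : d.edge ∈ M₁.1.edgeSet <;> by_cases h2 : d.edge ∈ M₂.1.edgeSet <;>
      simp [h1, h2] at e₁ ⊢
  have hall : ∀ d : G.Dart, (d.edge ∈ M₁.1.edgeSet ↔ d.edge ∈ M₂.1.edgeSet) := by
    intro d
    by_cases hd : col d.fst = VertexColour.white
    · exact hw d hd
    · rw [colour_fst_iff, not_not] at hd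
      simpa using hw d.symm hd
  apply PerfectMatching.ext_edgeSet
  ext e
  induction e using Sym2.ind with
  | _ v w =>
    by_cases hvw : G.Adj v w
    · exact hall ⟨(v, w), hvw⟩
    · exact iff_of_false (fun hm => hvw (M₁.1.adj_sub hm)) (fun hm => hvw (M₂.1.adj_sub hm))

theorem exists_isHeight (hp : Relation.ReflTransGen (P.Arc col) M₁ M₂) :
    ∃ h, P.IsHeight col M₁ M₂ h := by
  classical
  induction hp with
  | refl => exact ⟨0, IsHeight.refl _⟩
  | tail _ ha ih =>
    obtain ⟨h, hh⟩ := ih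
    obtain ⟨f, hf, hM⟩ := ha
    exact ⟨_, hh.trans (IsHeight.of_switch hf hM)⟩

end Height

/-! ### The covering relation of the poset of matchings. -/

section Order

variable {P} {col : G.Coloring VertexColour}

theorem matchingPoset_antisymm {M N : P.MatchingPoset col} (h₁ : M ≤ N) (h₂ : N ≤ M) : M = N := by
  obtain ⟨h, hh⟩ := exists_isHeight h₁
  obtain ⟨h', hh'⟩ := exists_isHeight h₂
  have h0 := (hh.trans hh').unique (IsHeight.refl N)
  -- The heights of a closed path sum to zero, and they take values in `ℕ`.
  obtain rfl : h = 0 := by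
    funext x
    have := congrFun h0 x
    simp only [Pi.add_apply, Pi.zero_apply] at this ⊢
    omega
  exact hh.eq_of_zero.symm

theorem matchingPoset_lt_iff {M N : P.MatchingPoset col} : M < N ↔ M ≤ N ∧ M ≠ N := by
  rw [lt_iff_le_not_ge]
  refine and_congr_right fun h => ⟨?_, fun hne h' => hne (matchingPoset_antisymm h h')⟩
  rintro hn rfl
  exact hn h

/-- The covering relation consists of the arcs of the `Z`-transformation digraph. -/
theorem covBy_iff_arc {M N : P.MatchingPoset col} : M ⋖ N ↔ P.Arc col N M := by
  classical
  constructor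
  · rintro ⟨hlt, hcov⟩
    obtain ⟨hle, hne⟩ := matchingPoset_lt_iff.1 hlt
    rcases Relation.ReflTransGen.cases_tail hle with h | ⟨K, hNK, hKM⟩
    · exact absurd h hne
    · have hMK : M < (show P.MatchingPoset col from K) := by
        refine matchingPoset_lt_iff.2 ⟨Relation.ReflTransGen.single hKM, ?_⟩
        rintro rfl
        obtain ⟨f, hf, hM⟩ := hKM
        obtain ⟨d, hd⟩ := hf.1.1.exists_dart
        have : d.edge ∈ (P.boundary f).edgeSet := P.mem_boundary.2 ⟨d, hd, rfl⟩
        rw [← hM, symmDiff_self] at this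
        exact this
      by_cases hKN : K = N
      · exact hKN ▸ hKM
      · exact absurd (matchingPoset_lt_iff.2 ⟨hNK, hKN⟩) (hcov hMK)
  · rintro ⟨f, hf, hM⟩
    have hh := IsHeight.of_switch hf hM
    refine ⟨matchingPoset_lt_iff.2 ⟨Relation.ReflTransGen.single ⟨f, hf, hM⟩, ?_⟩, ?_⟩
    · rintro rfl
      have := congrFun (hh.unique (IsHeight.refl M)) f
      simp at this
    · intro K hMK hKN
      rw [matchingPoset_lt_iff] at hMK hKN
      obtain ⟨h₁, hh₁⟩ := exists_isHeight hKN.1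
      obtain ⟨h₂, hh₂⟩ := exists_isHeight hMK.1
      -- The heights of the two halves add up to the indicator of `f`, so one of them is zero and
      -- `K` is an end of the arc.
      have hsum := (hh₁.trans hh₂).unique hh
      have hzero : ∀ x, x ≠ f → h₁ x = 0 ∧ h₂ x = 0 := by
        intro x hx
        have := congrFun hsum x
        rw [Pi.add_apply, Pi.single_eq_of_ne hx] at this
        omega
      have hf1 := congrFun hsum f
      rw [Pi.add_apply, Pi.single_eq_same] at hf1
      have hcase : h₁ f = 0 ∨ h₂ f = 0 := by omega
      rcases hcase with h0 | h0
      · obtain rfl : h₁ = 0 := by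
          funext x
          by_cases hx : x = f
          · rw [hx, h0]; rfl
          · exact (hzero x hx).1
        exact hKN.2 hh₁.eq_of_zero.symm
      · obtain rfl : h₂ = 0 := by
          funext x
          by_cases hx : x = f
          · rw [hx, h0]; rfl
          · exact (hzero x hx).2
        exact hMK.2 hh₂.eq_of_zero.symm

end Order

/-! ### The equivalences for a proper cell. -/

section MeetIrreducible

variable {P} {col : G.Coloring VertexColour} {M N : PerfectMatching G} {f : F}

theorem _root_.symmDiff_eq_iff_eq_symmDiff {α : Type*} [GeneralizedBooleanAlgebra α] {a b c : α} :
    symmDiff a b = c ↔ b = symmDiff a c := by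
  constructor
  · rintro rfl
    rw [symmDiff_symmDiff_cancel_left]
  · rintro rfl
    rw [symmDiff_symmDiff_cancel_left]

theorem IsProperCell.isMeetIrreducibleCell_iff (hf : P.IsProperCell col M f) :
    P.IsMeetIrreducibleCell col M f ↔
      ∀ g : F, P.IsImproperCell col M g → P.Intersects f g := by
  have hfd := isProperCell_iff.1 hf
  constructor
  · rintro ⟨-, N, hN, K, -, hKu⟩ g hg
    by_contra hfg
    have hgf : ¬ P.Intersects g f := fun ⟨v, h1, h2⟩ => hfg ⟨v, h2, h1⟩
    rw [isImproperCell_iff, ← IsDirectedCell.congr_of_not_intersects hgf hN] at hg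
    -- Being disjoint from `f`, the cell `g` is still improper for `N`, so `L = N ⊕ g` covers `N` as
    -- `M` does. Uniqueness gives `M = L`, which would make the boundaries of `f` and `g` equal.
    obtain ⟨L, hL⟩ := hg.exists_switch
    have hML : M = L := by
      rw [hKu M (covBy_iff_arc.2 ⟨f, hf, symmDiff_eq_iff_eq_symmDiff.2 hN⟩)]
      refine (hKu L (covBy_iff_arc.2 ⟨g, isProperCell_iff.2 (hg.reverse (by simp) hL), ?_⟩)).symm
      rw [symmDiff_comm, symmDiff_eq_iff_eq_symmDiff, hL]
    obtain ⟨d, hd⟩ := hf.1.1.exists_dart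
    have h1 : d.edge ∈ (P.boundary f).edgeSet := P.mem_boundary.2 ⟨d, hd, rfl⟩
    have h2 := not_edge_mem_boundary_of_not_intersects hfg hd
    rw [← hML, ← symmDiff_eq_iff_eq_symmDiff, symmDiff_comm,
      symmDiff_eq_iff_eq_symmDiff.2 hN] at hL
    exact h2 (hL ▸ h1)
  · intro hall
    obtain ⟨N, hN⟩ := hfd.exists_switch
    refine ⟨hf, N, hN, M, covBy_iff_arc.2 ⟨f, hf, symmDiff_eq_iff_eq_symmDiff.2 hN⟩, ?_⟩
    intro K hK
    obtain ⟨g, hg, hKN⟩ := covBy_iff_arc.1 hK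
    have hfN : P.IsDirectedCell col VertexColour.black N f := hfd.reverse (by simp) hN
    have hgN : P.IsDirectedCell col VertexColour.black N g :=
      (isProperCell_iff.1 hg).reverse (by simp) (symmDiff_eq_iff_eq_symmDiff.1 hKN)
    -- Both cells are improper for `N`. If distinct they would be disjoint, and `g` would be an
    -- improper cell for `M` that misses `f`.
    have hfg : f = g := by
      by_contra hne
      have hfg : ¬ P.Intersects f g := fun h => hne (hfN.eq_of_intersects hgN h)
      have hgf : ¬ P.Intersects g f := fun ⟨v, h1, h2⟩ => hfg ⟨v, h2, h1⟩
      rw [IsDirectedCell.congr_of_not_intersects hgf hN, ← isImproperCell_iff] at hgN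
      exact hfg (hall g hgN)
    subst hfg
    apply PerfectMatching.ext_edgeSet
    rw [symmDiff_comm, symmDiff_eq_iff_eq_symmDiff] at hKN
    rw [hKN, hN, symmDiff_symmDiff_cancel_right]

/-- At a common vertex the `M`-edge lies on both cells, so it belongs to the switched union and is
absent from `M'`. But a cell proper for `M` and `M'` has the same matched edges in both. -/
theorem IsProperCell.not_intersects_of_isProperCell {M' : PerfectMatching G}
    (hf : P.IsProperCell col M f) (hf' : P.IsProperCell col M' f) {T : Set F}
    (hM' : M'.1.edgeSet = symmDiff M.1.edgeSet (⋃ g ∈ T, (P.boundary g).edgeSet))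
    {g : F} (hgT : g ∈ T) (hg : P.IsImproperCell col M g) : ¬ P.Intersects f g := by
  rw [isProperCell_iff] at hf hf'
  rw [isImproperCell_iff] at hg
  rintro ⟨v, hvf, hvg⟩
  obtain ⟨d, hd, hdM, hdv⟩ := hf.exists_matched hvf
  obtain ⟨e, he, heM, hev⟩ := hg.exists_matched hvg
  have hedge : d.edge = e.edge := by
    rcases hdv with ⟨-, hdv⟩ | ⟨-, hdv⟩ <;> rcases hev with ⟨-, hev⟩ | ⟨-, hev⟩
    · rw [PerfectMatching.dart_eq M hdM heM (hdv.trans hev.symm)]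
    · rw [PerfectMatching.dart_eq M (e := e.symm) hdM (by simpa using heM) (hdv.trans hev.symm),
        SimpleGraph.Dart.edge_symm]
    · rw [← PerfectMatching.dart_eq M (d := d.symm) (by simpa using hdM) heM
        (hdv.trans hev.symm), SimpleGraph.Dart.edge_symm]
    · rw [← d.edge_symm, ← e.edge_symm, PerfectMatching.dart_eq M (d := d.symm) (e := e.symm)
        (by simpa using hdM) (by simpa using heM) (hdv.trans hev.symm)]
  have hdM' : d.edge ∈ M'.1.edgeSet := (hf'.2 d hd).2 ((hf.2 d hd).1 hdM)
  have hU : d.edge ∈ ⋃ g ∈ T, (P.boundary g).edgeSet :=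
    Set.mem_biUnion hgT (P.mem_boundary.2 ⟨e, he, hedge.symm⟩)
  rw [hM', Set.mem_symmDiff] at hdM'
  tauto

theorem IsProperCell.forall_intersects_iff (hf : P.IsProperCell col M f) :
    (∀ g : F, P.IsImproperCell col M g → P.Intersects f g) ↔
      ¬ ∃ M' : PerfectMatching G, M' ∈ P.hypercube M {g : F | P.IsImproperCell col M g} \ {M} ∧
        P.IsProperCell col M' f := by
  constructor
  · rintro hall ⟨M', ⟨⟨T, hT, hM'⟩, hne⟩, hf'⟩
    have hTe : T = ∅ := Set.eq_empty_of_forall_notMem fun g hg =>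
      hf.not_intersects_of_isProperCell hf' hM' hg (hT hg) (hall g (hT hg))
    subst hTe
    exact hne (PerfectMatching.ext_edgeSet (by
      rw [hM', Set.biUnion_empty]
      exact symmDiff_bot _))
  · intro hno g hg
    by_contra hfg
    obtain ⟨N, hN⟩ := (isImproperCell_iff.1 hg).exists_switch
    -- Switching only `g`, which is disjoint from `f`, leaves `f` proper and changes `M`.
    refine hno ⟨N, ⟨⟨{g}, by simpa using hg, by simpa using hN⟩, ?_⟩, ?_⟩
    · rintro rfl
      obtain ⟨d, hd⟩ := hg.1.1.exists_dart
      have h1 : d.edge ∈ (P.boundary g).edgeSet := P.mem_boundary.2 ⟨d, hd, rfl⟩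
      rw [← symmDiff_eq_iff_eq_symmDiff, symmDiff_self] at hN
      rw [← hN] at h1
      exact h1
    · rw [isProperCell_iff, IsDirectedCell.congr_of_not_intersects hfg hN, ← isProperCell_iff]
      exact hf

end MeetIrreducible

end PlaneGraph

/-- Height functions make the covering relation equal to the arcs of the digraph for every plane
bipartite graph, so the elementarity hypothesis `hG` is not needed. -/
theorem theorem3p3 {V F : Type*} [Finite V] {G : SimpleGraph V} (P : PlaneGraph G F)
    (col : G.Coloring VertexColour) (hG : IsElementaryGraph G ∨ P.IsWeaklyElementary)
    (M : PerfectMatching G) :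
    ((¬ ∃ g : F, P.IsImproperCell col M g) →
      ∀ f : F, P.IsProperCell col M f → P.IsMeetIrreducibleCell col M f) ∧
    ((∃ g : F, P.IsImproperCell col M g) →
      ∀ f : F, P.IsProperCell col M f →
        List.TFAE [
          P.IsMeetIrreducibleCell col M f,
          ∀ g : F, P.IsImproperCell col M g → P.Intersects f g,
          ¬ ∃ M' : PerfectMatching G,
            M' ∈ P.hypercube M {g : F | P.IsImproperCell col M g} \ {M} ∧
              P.IsProperCell col M' f]) := by
  refine ⟨fun hno f hf => hf.isMeetIrreducibleCell_iff.2 fun g hg => (hno ⟨g, hg⟩).elim,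
    fun _ f hf => ?_⟩
  tfae_have 1 ↔ 2 := hf.isMeetIrreducibleCell_iff
  tfae_have 2 ↔ 3 := hf.forall_intersects_iff
  tfae_finish
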